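/- Let $b_1(i,j), b_2(i,j)\in[0,1]$, $i,j\in\mathbb Z_{\ge1}$, be parameters that are periodic: for some integers $I,J\ge1$, $b_k(i+I,j)=b_k(i,j)=b_k(i,j+J)$ for all $i,j\ge1$ and $k\in\{1,2\}$. Consider the complemented stochastic six vertex (CS6V) model on the quadrant $\mathbb Z_{\ge1}^2$ with these parameters and empty boundary data. That is, no lines enter the quadrant from the left or from the bottom, and the vertices are sampled one after another in the order $(1,1),(2,1),(1,2),(3,1),(2,2),(1,3),\dots$. Given all outputs sampled before and the numbers of lines (each $0$ or $1$) on its bottom and left edges (the right edge of a vertex is the left edge of its right neighbour, and the top edge of a vertex is the bottom edge of its upper neighbour), the vertex $(i,j)$ receives the numbers of lines on its top and right edges according to the probabilities $L(\text{bottom},\text{left};\text{top},\text{right})$ $$L(1,0;1,0)=1,\qquad L(0,1;0,1)=1,\qquad L(1,1;1,1)=b_1(i,j),\qquad L(1,1;0,0)=1-b_1(i,j),$$ $$L(0,0;0,0)=b_2(i,j),\qquad L(0,0;1,1)=1-b_2(i,j),$$ all other values of $L$ being $0$. For integers $x,y\ge0$ let $H(x,y)$ be the number of lines that cross the segment $[\tfrac12,x+\tfrac12]\times\{y+\tfrac12\}$,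 i.e. the number of $a\in\{1,\dots,x\}$ such that there is a line on the edge from $(a,y)$ to $(a,y+1)$ (so $H(x,0)=H(0,y)=0$). Proposition 3.5. For all fixed $x,y\in\mathbb Q_{\ge0}$ there is a constant $\widetilde g(x,y)\in\mathbb R_{\ge0}$ (depending only on $x$, $y$ and the parameters) such that, almost surely, $$\lim_{n\to\infty}\frac{H(\lfloor nx\rfloor,\lfloor ny\rfloor)}{n}=\widetilde g(x,y).$$ -/

import Mathlib

open MeasureTheory Filter Topology

/-- The weights of the complemented stochastic six vertex (CS6V) model at a vertex with parameters
`b₁, b₂`. The arguments `i j k l` say whether there is a line on the bottom, left (inputs) and on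
the top, right (outputs) of the vertex: `cs6vWeight b₁ b₂ i j k l` is the probability of the
outputs `k, l` given the inputs `i, j`. -/
def cs6vWeight (b₁ b₂ : ℝ) : Bool → Bool → Bool → Bool → ℝ
  | true, false, true, false => 1
  | false, true, false, true => 1
  | true, true, true, true => b₁
  | true, true, false, false => 1 - b₁
  | false, false, false, false => b₂
  | false, false, true, true => 1 - b₂
  | _, _, _, _ => 0

/-- The order `(1, 1), (2, 1), (1, 2), (3, 1), (2, 2), (1, 3), …` in which the vertices of the
quadrant are sampled: `SampledBefore p q` says that `p` comes strictly before `q`. -/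
def SampledBefore (p q : ℕ × ℕ) : Prop :=
  p.1 + p.2 < q.1 + q.2 ∨ (p.1 + p.2 = q.1 + q.2 ∧ p.2 < q.2)

/-- The σ-algebra generated by the outputs (top and right edges) of all vertices of the quadrant
that are sampled strictly before `q`. -/
abbrev cs6vPast {Ω : Type*} (top right : ℕ → ℕ → Ω → Bool) (q : ℕ × ℕ) : MeasurableSpace Ω :=
  ⨆ p : {p : ℕ × ℕ // 1 ≤ p.1 ∧ 1 ≤ p.2 ∧ SampledBefore p q},
    MeasurableSpace.comap (top p.1.1 p.1.2) ⊤ ⊔ MeasurableSpace.comap (right p.1.1 p.1.2) ⊤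

/-- A realization, on the probability space `(Ω, P)`, of the CS6V model on the first quadrant
(vertices `(i, j)` with `i, j ≥ 1`) with parameters `b₁ i j`, `b₂ i j` and empty boundary data.

`top i j ω` says whether there is a (vertical) line on the edge from `(i, j)` to `(i, j + 1)`, and
`right i j ω` whether there is a (horizontal) line on the edge from `(i, j)` to `(i + 1, j)`.
So the inputs of the vertex `(i, j)` are `top i (j - 1)` (bottom) and `right (i - 1) j` (left);
`top i 0` and `right 0 j` are the boundary data.

The last field is the sampling rule: conditionally on the outputs of all the vertices sampled
earlier, the outputs of `(i, j)` are distributed according to the weights given its inputs. -/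
structure IsCS6V {Ω : Type*} [MeasurableSpace Ω] (P : Measure Ω) (b₁ b₂ : ℕ → ℕ → ℝ)
    (top right : ℕ → ℕ → Ω → Bool) : Prop where
  measurable_top : ∀ i j, Measurable (top i j)
  measurable_right : ∀ i j, Measurable (right i j)
  bottom_empty : ∀ i, 1 ≤ i → ∀ ω, top i 0 ω = false
  left_empty : ∀ j, 1 ≤ j → ∀ ω, right 0 j ω = false
  sampling : ∀ i j, 1 ≤ i → 1 ≤ j → ∀ A : Set Ω, MeasurableSet[cs6vPast top right (i, j)] A →
    ∀ inB inL outT outR : Bool,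
      P.real (A ∩ {ω | top i (j - 1) ω = inB ∧ right (i - 1) j ω = inL}
          ∩ {ω | top i j ω = outT ∧ right i j ω = outR}) =
        cs6vWeight (b₁ i j) (b₂ i j) inB inL outT outR *
          P.real (A ∩ {ω | top i (j - 1) ω = inB ∧ right (i - 1) j ω = inL})

/-- The height function: `cs6vHeight top x y ω` is the number of lines that cross the horizontal
segment `[1/2, x + 1/2] × {y + 1/2}`, i.e. the number of down-right paths that separate the
corner `(1/2, 1/2)` from the point `(x + 1/2, y + 1/2)`. -/
def cs6vHeight {Ω : Type*} (top : ℕ → ℕ → Ω → Bool) (x y : ℕ) (ω : Ω) : ℕ :=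
  ((Finset.Icc 1 x).filter fun a => top a y ω = true).card

/-!
The height function of the CS6V model is superadditive, and a superadditive ergodic theorem gives
the limit.

*Superadditivity.* Give every vertex its own independent uniform noise, which decides the outputs
of the vertex from its inputs. In the picture where horizontal edges are complemented, lines are
conserved at the vertices and the vertex rule is attractive: with the same noise, more lines from
below and fewer from the left produce more lines to the top and fewer to the right
(`IsLineConfig.mono`). Comparing the model beyond a corner `(a, b)` with the model restarted there
with empty boundary, via the configuration with the actual lines from below but none from the left,
shows that the height difference between `(a, b)` and `(a + x, b + y)` is at least the height of
the restarted model (`emptyHeight_superadditive`). No monotonicity of heights in their boundary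
values is used; it fails if `b₁ + b₂ > 1`.

*Limit.* If `(X, Y)` is a period, the restarted models at the corners `(k X, k Y)` arise from
translations of the noise, which preserve its law, and heights over disjoint diagonal blocks are
independent. Let `H n` be the height at `(n X, n Y)` and `γ` the supremum of the means of `H n / n`.
The strong law for long blocks gives `liminf H n / n ≥ γ`. If `limsup H n / n > a > γ` held on an
event `A` of positive probability, then, `A` being invariant up to null sets, `[0, N)` could be
covered on `A` mostly by intervals of bounded length on which the process gains at least `a` per
unit of time (`IsSuperadditiveProcess.covering`). So the mean of `H N` would be at least about `a N`
per unit of mass on `A`, and at least about `γ N` per unit of mass on its complement, which exceeds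
the upper bound `γ N` (`IsSuperadditiveProcess.measure_fastSet_eq_zero`).

*Transfer.* The sampling rule determines the law of the outputs, since the probability of given
outputs on an initial segment of the sampling order is a product of weights
(`IsCS6V.real_outputs_eq`, `IsCS6V.map_outputs_eq`). So the limit for the model built from noise
holds for every realization.
-/

/-! ### Line configurations driven by a fixed noise -/

/-- The outputs (top, right) of a vertex with inputs `inB` (bottom) and `inL` (left): a single line
goes straight through, and two equal inputs are both replaced by the bit `α` (if they are lines) or
`β` (if they are not). The bits `α`, `β` are the noise of the vertex. -/
def vertexOut (α β inB inL : Bool) : Bool × Bool :=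
  if inB = inL then (if inB then (α, α) else (β, β)) else (inB, inL)

/-- `T` (top edges) and `R` (right edges) obey the vertex rule with noise `α`, `β` at every vertex
of the quadrant; the boundary values `T i 0` and `R 0 j` are arbitrary. -/
def IsLineConfig (α β T R : ℕ → ℕ → Bool) : Prop :=
  ∀ i j, (T (i + 1) (j + 1), R (i + 1) (j + 1)) =
    vertexOut (α (i + 1) (j + 1)) (β (i + 1) (j + 1)) (T (i + 1) j) (R i (j + 1))

/-- The outputs (top, right) of the vertices for the noise `α`, `β`, with the lines `bot` entering
the quadrant from the bottom and no lines entering from the left. -/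
def evolve (α β : ℕ → ℕ → Bool) (bot : ℕ → Bool) : ℕ → ℕ → Bool × Bool
  | i, 0 => (bot i, false)
  | 0, _ + 1 => (false, false)
  | i + 1, j + 1 =>
    vertexOut (α (i + 1) (j + 1)) (β (i + 1) (j + 1))
      (evolve α β bot (i + 1) j).1 (evolve α β bot i (j + 1)).2

/-- The number of vertical lines leaving the vertices `(1, y), …, (x, y)` through the top. -/
def topCount (T : ℕ → ℕ → Bool) (x y : ℕ) : ℕ := ∑ a ∈ Finset.range x, (T (a + 1) y).toNat

/-- The number of horizontal lines leaving the vertices `(x, 1), …, (x, y)` to the right. -/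
def rightCount (R : ℕ → ℕ → Bool) (x y : ℕ) : ℕ := ∑ b ∈ Finset.range y, (R x (b + 1)).toNat

lemma isLineConfig_evolve (α β : ℕ → ℕ → Bool) (bot : ℕ → Bool) :
    IsLineConfig α β (fun i j => (evolve α β bot i j).1) (fun i j => (evolve α β bot i j).2) := by
  intro i j
  simp only [evolve]

lemma evolve_zero_left (α β : ℕ → ℕ → Bool) (bot : ℕ → Bool) (j : ℕ) :
    (evolve α β bot 0 j).2 = false := by
  cases j <;> simp [evolve]

lemma evolve_zero_bottom (α β : ℕ → ℕ → Bool) (bot : ℕ → Bool) (i : ℕ) :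
    (evolve α β bot i 0).1 = bot i := by
  simp [evolve]

lemma evolve_congr {α β α' β' : ℕ → ℕ → Bool} (bot : ℕ → Bool)
    (hα : ∀ i j, α (i + 1) (j + 1) = α' (i + 1) (j + 1))
    (hβ : ∀ i j, β (i + 1) (j + 1) = β' (i + 1) (j + 1)) :
    ∀ i j, evolve α β bot i j = evolve α' β' bot i j
  | i, 0 => by simp [evolve]
  | 0, _ + 1 => by simp [evolve]
  | i + 1, j + 1 => by
    simp only [evolve, hα, hβ, evolve_congr bot hα hβ (i + 1) j, evolve_congr bot hα hβ i (j + 1)]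

lemma IsLineConfig.shift {α β T R : ℕ → ℕ → Bool} (h : IsLineConfig α β T R) (a b : ℕ) :
    IsLineConfig (fun i j => α (i + a) (j + b)) (fun i j => β (i + a) (j + b))
      (fun i j => T (i + a) (j + b)) (fun i j => R (i + a) (j + b)) := by
  intro i j
  have := h (i + a) (j + b)
  simpa only [add_right_comm _ 1] using this

/-- Attractivity at one vertex: with the same noise, more lines from below and fewer from the left
give more lines to the top and fewer to the right. -/
lemma vertexOut_mono (α β : Bool) {inB inL inB' inL' : Bool} (hB : inB ≤ inB') (hL : inL' ≤ inL) :
    (vertexOut α β inB inL).1 ≤ (vertexOut α β inB' inL').1 ∧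
      (vertexOut α β inB' inL').2 ≤ (vertexOut α β inB inL).2 := by
  revert hB hL
  revert α β inB inL inB' inL'
  decide

/-- Attractivity: two line configurations with the same noise stay ordered if their boundary values
are. -/
lemma IsLineConfig.mono {α β T R T' R' : ℕ → ℕ → Bool} (h : IsLineConfig α β T R)
    (h' : IsLineConfig α β T' R') (hT : ∀ i, T (i + 1) 0 ≤ T' (i + 1) 0)
    (hR : ∀ j, R' 0 (j + 1) ≤ R 0 (j + 1)) :
    ∀ i j, T (i + 1) j ≤ T' (i + 1) j ∧ R' i (j + 1) ≤ R i (j + 1)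
  | 0, 0 => ⟨hT 0, hR 0⟩
  | i + 1, 0 => by
    refine ⟨hT _, ?_⟩
    have := vertexOut_mono (α (i + 1) 1) (β (i + 1) 1) (hT i) (h.mono h' hT hR i 0).2
    rw [← h i 0, ← h' i 0] at this
    exact this.2
  | 0, j + 1 => by
    refine ⟨?_, hR _⟩
    have := vertexOut_mono (α 1 (j + 1)) (β 1 (j + 1)) (h.mono h' hT hR 0 j).1 (hR j)
    rw [← h 0 j, ← h' 0 j] at this
    exact this.1
  | i + 1, j + 1 => by
    have h1 := vertexOut_mono (α (i + 1 + 1) (j + 1)) (β (i + 1 + 1) (j + 1))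
      (h.mono h' hT hR (i + 1) j).1 (h.mono h' hT hR (i + 1) j).2
    have h2 := vertexOut_mono (α (i + 1) (j + 1 + 1)) (β (i + 1) (j + 1 + 1))
      (h.mono h' hT hR i (j + 1)).1 (h.mono h' hT hR i (j + 1)).2
    rw [← h (i + 1) j, ← h' (i + 1) j] at h1
    rw [← h i (j + 1), ← h' i (j + 1)] at h2
    exact ⟨h1.1, h2.2⟩
termination_by i j => i + j

/-- At a vertex the numbers of lines satisfy `top + left = bottom + right`. -/
lemma vertexOut_conserve (α β inB inL : Bool) :
    (vertexOut α β inB inL).1.toNat + inL.toNat = inB.toNat + (vertexOut α β inB inL).2.toNat := by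
  revert α β inB inL
  decide

/-- Counting the lines between `(0, 0)` and `(x, y)` along either side of the rectangle gives the
same number. -/
lemma IsLineConfig.conserve {α β T R : ℕ → ℕ → Bool} (h : IsLineConfig α β T R) (x y : ℕ) :
    topCount T x y + rightCount R 0 y = topCount T x 0 + rightCount R x y := by
  induction x with
  | zero => simp [topCount]
  | succ x ih =>
    have key : (T (x + 1) y).toNat + rightCount R x y =
        (T (x + 1) 0).toNat + rightCount R (x + 1) y := by
      clear ih
      induction y with
      | zero => simp [rightCount]
      | succ y ih =>
        have hv := vertexOut_conserve (α (x + 1) (y + 1)) (β (x + 1) (y + 1)) (T (x + 1) y)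
          (R x (y + 1))
        rw [← h x y] at hv
        simp only [rightCount, Finset.sum_range_succ] at ih hv ⊢
        omega
    simp only [topCount, Finset.sum_range_succ] at ih ⊢
    omega

lemma bool_toNat_mono {a b : Bool} (h : a ≤ b) : a.toNat ≤ b.toNat := by
  revert a b; decide

/-- The height at `(x, y)` of the configuration with empty boundary and noise `α`, `β`. -/
def emptyHeight (α β : ℕ → ℕ → Bool) (x y : ℕ) : ℕ :=
  topCount (fun i j => (evolve α β (fun _ => false) i j).1) x y

lemma emptyHeight_eq_rightCount (α β : ℕ → ℕ → Bool) (x y : ℕ) :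
    emptyHeight α β x y = rightCount (fun i j => (evolve α β (fun _ => false) i j).2) x y := by
  have := (isLineConfig_evolve α β (fun _ => false)).conserve x y
  simpa [emptyHeight, topCount, rightCount, evolve_zero_left, evolve_zero_bottom] using this

/-- With any boundary values, the height difference between `(0, 0)` and `(x, y)` (counted along the
bottom and right sides) is at least the height of the configuration with empty boundary and the same
noise. The comparison goes through the configuration that has the given lines entering from the
bottom and none from the left. -/
lemma IsLineConfig.emptyHeight_le {α β T R : ℕ → ℕ → Bool} (h : IsLineConfig α β T R) (x y : ℕ) :
    emptyHeight α β x y ≤ topCount T x 0 + rightCount R x y := by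
  have hA := isLineConfig_evolve α β (fun _ => false)
  have hC := isLineConfig_evolve α β (fun i => T i 0)
  have h1 := hA.mono hC (by simp [evolve_zero_bottom]) (by simp [evolve_zero_left])
  have h2 := h.mono hC (by simp [evolve_zero_bottom]) (by simp [evolve_zero_left])
  have h3 := hC.conserve x y
  have e1 : emptyHeight α β x y ≤ topCount (fun i j => (evolve α β (fun i => T i 0) i j).1) x y := by
    unfold emptyHeight topCount
    exact Finset.sum_le_sum fun a _ => bool_toNat_mono (h1 a y).1
  have e2 : rightCount (fun i j => (evolve α β (fun i => T i 0) i j).2) x y ≤ rightCount R x y :=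
    Finset.sum_le_sum fun b _ => bool_toNat_mono (h2 x b).2
  have e3 : topCount (fun i j => (evolve α β (fun i => T i 0) i j).1) x 0 = topCount T x 0 := by
    simp [topCount, evolve_zero_bottom]
  omega

/-- Superadditivity of the height. -/
lemma emptyHeight_superadditive (α β : ℕ → ℕ → Bool) (a b x y : ℕ) :
    emptyHeight α β a b +
        emptyHeight (fun i j => α (i + a) (j + b)) (fun i j => β (i + a) (j + b)) x y ≤
      emptyHeight α β (x + a) (y + b) := by
  have h := ((isLineConfig_evolve α β (fun _ => false)).shift a b).emptyHeight_le x y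
  have hsplit := emptyHeight_eq_rightCount α β (x + a) (y + b)
  have hb := emptyHeight_eq_rightCount α β (x + a) b
  have e1 : emptyHeight α β (x + a) b = emptyHeight α β a b +
      topCount (fun i j => (evolve α β (fun _ => false) (i + a) (j + b)).1) x 0 := by
    simp only [emptyHeight, topCount]
    rw [add_comm x a, Finset.sum_range_add]
    simp [add_comm, add_assoc]
  have e2 : rightCount (fun i j => (evolve α β (fun _ => false) i j).2) (x + a) (y + b) =
      rightCount (fun i j => (evolve α β (fun _ => false) i j).2) (x + a) b +
      rightCount (fun i j => (evolve α β (fun _ => false) (i + a) (j + b)).2) x y := by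
    simp only [rightCount]
    rw [add_comm y b, Finset.sum_range_add]
    simp [add_comm, add_assoc]
  omega

lemma topCount_le (T : ℕ → ℕ → Bool) (x y : ℕ) : topCount T x y ≤ x := by
  simpa [topCount] using Finset.sum_le_card_nsmul (Finset.range x) (fun a => (T (a + 1) y).toNat) 1
    (fun a _ => Bool.toNat_le _)

lemma emptyHeight_mono (α β : ℕ → ℕ → Bool) {x y x' y' : ℕ} (hx : x ≤ x') (hy : y ≤ y') :
    emptyHeight α β x y ≤ emptyHeight α β x' y' := by
  obtain ⟨u, rfl⟩ := Nat.exists_eq_add_of_le' hx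
  obtain ⟨v, rfl⟩ := Nat.exists_eq_add_of_le' hy
  exact le_trans (Nat.le_add_right _ _) (emptyHeight_superadditive α β x y u v)

/-! ### A superadditive ergodic theorem with independent blocks -/

/-- A nonnegative process `H n`, bounded by `C * n`, that is superadditive along the measure
preserving map `θ`. -/
structure IsSuperadditiveProcess {Ω : Type*} [MeasurableSpace Ω] (μ : Measure Ω) (θ : Ω → Ω)
    (H : ℕ → Ω → ℝ) (C : ℝ) : Prop where
  measurePreserving : MeasurePreserving θ μ μ
  measurable : ∀ n, Measurable (H n)
  nonneg : ∀ n ω, 0 ≤ H n ω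
  le : ∀ n ω, H n ω ≤ C * n
  superadditive : ∀ m n ω, H m ω + H n (θ^[m] ω) ≤ H (m + n) ω

namespace IsSuperadditiveProcess

variable {Ω : Type*} [MeasurableSpace Ω] {μ : Measure Ω} {θ : Ω → Ω} {H : ℕ → Ω → ℝ} {C : ℝ}

lemma mono (h : IsSuperadditiveProcess μ θ H C) {m n : ℕ} (hmn : m ≤ n) (ω : Ω) :
    H m ω ≤ H n ω := by
  obtain ⟨k, rfl⟩ := Nat.exists_eq_add_of_le hmn
  linarith [h.superadditive m k ω, h.nonneg k (θ^[m] ω)]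

lemma sum_le (h : IsSuperadditiveProcess μ θ H C) (m K : ℕ) (ω : Ω) :
    ∑ k ∈ Finset.range K, H m (θ^[k * m] ω) ≤ H (K * m) ω := by
  induction K with
  | zero => simpa using h.nonneg _ _
  | succ K ih =>
    rw [Finset.sum_range_succ, Nat.succ_mul]
    linarith [h.superadditive (K * m) m ω]

lemma integrable [IsProbabilityMeasure μ] (h : IsSuperadditiveProcess μ θ H C) (n : ℕ) :
    Integrable (H n) μ :=
  Integrable.of_bound (h.measurable n).aestronglyMeasurable (C * n)
    (Eventually.of_forall fun ω => by
      rw [Real.norm_of_nonneg (h.nonneg n ω)]; exact h.le n ω)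

/-- By the strong law for blocks of length `m`, the growth rate is at least the mean rate over one
block. -/
lemma ae_eventually_ge_of_block [IsProbabilityMeasure μ] (h : IsSuperadditiveProcess μ θ H C)
    (m : ℕ) (hm : 1 ≤ m)
    (hind : Pairwise fun k l => ProbabilityTheory.IndepFun
      (fun ω => H m (θ^[k * m] ω)) (fun ω => H m (θ^[l * m] ω)) μ) :
    ∀ᵐ ω ∂μ, ∀ c < (∫ ω, H m ω ∂μ) / m, ∀ᶠ n : ℕ in atTop, c * n ≤ H n ω := by
  have hmp : ∀ k, MeasurePreserving θ^[k] μ μ := fun k => h.measurePreserving.iterate k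
  have key := ProbabilityTheory.strong_law_ae_real (μ := μ) (fun k ω => H m (θ^[k * m] ω))
    (by simpa using h.integrable m) hind
    (fun k => by
      have e : (fun ω => H m (θ^[0 * m] ω)) = H m := by simp
      rw [e]
      refine ⟨((h.measurable m).comp (hmp _).measurable).aemeasurable,
        (h.measurable m).aemeasurable, ?_⟩
      have := (hmp (k * m)).map_eq
      conv_rhs => rw [← this]
      rw [Measure.map_map (h.measurable m) (hmp _).measurable]
      rfl)
  filter_upwards [key] with ω hω c hc
  have hm0 : (0 : ℝ) < m := by exact_mod_cast hm
  have hfl : Tendsto (fun n : ℕ => ((n / m : ℕ) : ℝ) / n) atTop (𝓝 (1 / m)) := by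
    have := (tendsto_nat_floor_mul_div_atTop (R := ℝ) (a := 1 / (m : ℝ)) (by positivity)).comp
      tendsto_natCast_atTop_atTop
    refine this.congr fun n => ?_
    simp only [Function.comp_apply]
    rw [one_div_mul_eq_div, Nat.floor_div_eq_div]
  have hdiv : Tendsto (fun n : ℕ => n / m) atTop atTop :=
    Nat.tendsto_div_const_atTop (by omega)
  have hlim := (hω.comp hdiv).mul hfl
  simp only [zero_mul, Function.iterate_zero, id_eq, mul_one_div] at hlim
  filter_upwards [hlim.eventually_const_lt hc, hdiv.eventually_ge_atTop 1, eventually_gt_atTop 0]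
    with n h1 h2 h3
  have hn : (0 : ℝ) < n := by exact_mod_cast h3
  have hq : ((n / m : ℕ) : ℝ) ≠ 0 := by
    have : 0 < n / m := h2
    exact_mod_cast this.ne'
  simp only [Function.comp_apply] at h1
  rw [div_mul_div_cancel₀ hq, lt_div_iff₀ hn] at h1
  exact h1.le.trans ((h.sum_le m _ ω).trans (h.mono (Nat.div_mul_le_self n m) ω))

/-- Covering argument: cut `[0, N)` greedily into intervals of length at most `M` on which the
process gains at least `a` per unit of time, and single points `s` from which no such interval
starts. -/
lemma covering (h : IsSuperadditiveProcess μ θ H C) {a : ℝ} (ha : 0 ≤ a) {M : ℕ}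
    {G : Set Ω} (hG : ∀ ω ∈ G, ∃ n, 1 ≤ n ∧ n ≤ M ∧ a * n ≤ H n ω) (N : ℕ) (ω : Ω) :
    a * N ≤ H N ω + a * ∑ s ∈ Finset.range N, Gᶜ.indicator 1 (θ^[s] ω) + a * M := by
  classical
  have hpos : ∀ K ω, (0 : ℝ) ≤ ∑ s ∈ Finset.range K, Gᶜ.indicator 1 (θ^[s] ω) := fun K ω =>
    Finset.sum_nonneg fun s _ => Set.indicator_nonneg (fun _ _ => zero_le_one) _
  induction N using Nat.strong_induction_on generalizing ω with
  | _ N ih =>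
    by_cases hNM : N < M + 1
    · have : (N : ℝ) ≤ M := by exact_mod_cast Nat.lt_succ_iff.mp hNM
      nlinarith [h.nonneg N ω, hpos N ω, mul_nonneg ha (hpos N ω), mul_le_mul_of_nonneg_left this ha]
    -- one step of length `n`, whatever its origin
    have step : ∀ n, 1 ≤ n → n ≤ N →
        a * n ≤ H n ω + a * ∑ s ∈ Finset.range n, Gᶜ.indicator 1 (θ^[s] ω) →
        a * N ≤ H N ω + a * ∑ s ∈ Finset.range N, Gᶜ.indicator 1 (θ^[s] ω) + a * M := by
      intro n h1 h2 h3
      obtain ⟨k, rfl⟩ := Nat.exists_eq_add_of_le h2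
      have := ih k (by omega) (θ^[n] ω)
      have hs := h.superadditive n k ω
      have e : ∀ s, θ^[n + s] ω = θ^[s] (θ^[n] ω) := fun s => by
        rw [add_comm, Function.iterate_add_apply]
      rw [Finset.sum_range_add]
      simp only [e]
      push_cast
      linarith
    by_cases hω : ω ∈ G
    · obtain ⟨n, h1, h2, h3⟩ := hG ω hω
      exact step n h1 (by omega) (by nlinarith [mul_nonneg ha (hpos n ω)])
    · refine step 1 le_rfl (by omega) ?_
      have : Gᶜ.indicator (1 : Ω → ℝ) ω = 1 := Set.indicator_of_mem hω 1
      simp [this, h.nonneg 1 ω]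

/-- The event that the upper growth rate exceeds `a`. -/
def fastSet (H : ℕ → Ω → ℝ) (a : ℝ) : Set Ω :=
  {ω | ∃ k : ℕ, ∃ᶠ n : ℕ in atTop, (a + 1 / ((k : ℝ) + 1)) * n ≤ H n ω}

lemma measurableSet_fastSet (h : IsSuperadditiveProcess μ θ H C) (a : ℝ) :
    MeasurableSet (fastSet H a) := by
  have : fastSet H a = ⋃ k : ℕ, ⋂ N : ℕ, ⋃ n : ℕ, ⋃ _ : N ≤ n,
      {ω | (a + 1 / ((k : ℝ) + 1)) * n ≤ H n ω} := by
    ext ω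
    simp [fastSet, frequently_atTop]
  rw [this]
  exact .iUnion fun k => .iInter fun N => .iUnion fun n => .iUnion fun _ =>
    measurableSet_le measurable_const (h.measurable n)

lemma preimage_fastSet_subset (h : IsSuperadditiveProcess μ θ H C) (a : ℝ) (s : ℕ) :
    θ^[s] ⁻¹' fastSet H a ⊆ fastSet H a := by
  have one : θ ⁻¹' fastSet H a ⊆ fastSet H a := by
    rintro ω ⟨k, hk⟩
    refine ⟨k + 1, ?_⟩
    have hgap : (0 : ℝ) < 1 / ((k : ℝ) + 1) - 1 / ((k + 1 : ℕ) + 1) := by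
      rw [sub_pos]
      apply one_div_lt_one_div_of_lt <;> push_cast <;> linarith [(k.cast_nonneg : (0 : ℝ) ≤ k)]
    have hev : ∀ᶠ n : ℕ in atTop, a + 1 / ((k + 1 : ℕ) + 1) ≤
        (1 / ((k : ℝ) + 1) - 1 / ((k + 1 : ℕ) + 1)) * n :=
      (tendsto_natCast_atTop_atTop.const_mul_atTop hgap).eventually_ge_atTop _
    refine (tendsto_add_atTop_nat 1).frequently ((hk.and_eventually hev).mono ?_)
    rintro n ⟨h1, h2⟩
    have h3 := h.superadditive 1 n ω
    have h4 := h.nonneg 1 ω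
    rw [Function.iterate_one, add_comm 1 n] at h3
    push_cast at h2 ⊢
    linarith
  induction s with
  | zero => simp
  | succ s ih =>
    rw [Function.iterate_succ', Set.preimage_comp]
    exact (Set.preimage_mono one).trans ih

/-- The preimage is contained in the set itself and has the same measure. -/
lemma measure_fastSet_diff_preimage [IsProbabilityMeasure μ] (h : IsSuperadditiveProcess μ θ H C)
    (a : ℝ) (s : ℕ) : μ (fastSet H a \ θ^[s] ⁻¹' fastSet H a) = 0 := by
  have hmp : MeasurePreserving θ^[s] μ μ := h.measurePreserving.iterate s
  have hA := h.measurableSet_fastSet a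
  rw [measure_sdiff (h.preimage_fastSet_subset a s) (hmp.measurable hA).nullMeasurableSet
    (measure_ne_top _ _), hmp.measure_preimage hA.nullMeasurableSet, tsub_self]

/-- On the event that the upper growth rate exceeds `a`, the mean growth is at least `a` per unit of
time, up to an error that is small if `M`, and then `N`, is large. -/
lemma setIntegral_fastSet_ge [IsProbabilityMeasure μ] (h : IsSuperadditiveProcess μ θ H C)
    {a : ℝ} (ha : 0 ≤ a) (M N : ℕ) {G : Set Ω} (hGm : MeasurableSet G)
    (hG : ∀ ω ∈ G, ∃ n, 1 ≤ n ∧ n ≤ M ∧ a * n ≤ H n ω) :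
    a * N * μ.real (fastSet H a) ≤ ∫ ω in fastSet H a, H N ω ∂μ +
      a * N * μ.real (fastSet H a ∩ Gᶜ) + a * M := by
  set A := fastSet H a with hAdef
  have hA : MeasurableSet A := h.measurableSet_fastSet a
  have hmp : ∀ s, MeasurePreserving θ^[s] μ μ := fun s => h.measurePreserving.iterate s
  have hbad : ∀ s, μ.real (A ∩ θ^[s] ⁻¹' Gᶜ) ≤ μ.real (A ∩ Gᶜ) := fun s => by
    have hsub : A ∩ θ^[s] ⁻¹' Gᶜ ⊆ (A \ θ^[s] ⁻¹' A) ∪ θ^[s] ⁻¹' (A ∩ Gᶜ) := by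
      intro ω hω
      by_cases hs : θ^[s] ω ∈ A
      · exact Or.inr ⟨hs, hω.2⟩
      · exact Or.inl ⟨hω.1, hs⟩
    refine ENNReal.toReal_mono (measure_ne_top _ _) ((measure_mono hsub).trans ?_)
    refine (measure_union_le _ _).trans ?_
    rw [h.measure_fastSet_diff_preimage a s, zero_add,
      (hmp s).measure_preimage (hA.inter hGm.compl).nullMeasurableSet]
  have hcomp : ∀ s, (fun ω => Gᶜ.indicator (1 : Ω → ℝ) (θ^[s] ω)) =
      (θ^[s] ⁻¹' Gᶜ).indicator (fun _ => (1 : ℝ)) := fun s => rfl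
  have hint : ∀ s, Integrable (fun ω => Gᶜ.indicator (1 : Ω → ℝ) (θ^[s] ω)) (μ.restrict A) :=
    fun s => by
      rw [hcomp]
      exact (integrable_const (1 : ℝ)).indicator ((hmp s).measurable hGm.compl)
  have hval : ∀ s, ∫ ω in A, Gᶜ.indicator (1 : Ω → ℝ) (θ^[s] ω) ∂μ =
      μ.real (A ∩ θ^[s] ⁻¹' Gᶜ) := fun s => by
    rw [hcomp, integral_indicator_const _ ((hmp s).measurable hGm.compl)]
    simp only [smul_eq_mul, mul_one]
    rw [measureReal_restrict_apply ((hmp s).measurable hGm.compl), Set.inter_comm]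
  have hHN : Integrable (H N) (μ.restrict A) := (h.integrable N).restrict
  have hsum : Integrable (fun ω => ∑ s ∈ Finset.range N, Gᶜ.indicator (1 : Ω → ℝ) (θ^[s] ω))
      (μ.restrict A) := integrable_finsetSum _ fun s _ => hint s
  have main := integral_mono (μ := μ.restrict A) (integrable_const (a * N))
    ((hHN.add (hsum.const_mul a)).add (integrable_const (a * M)))
    (fun ω => h.covering ha hG N ω)
  rw [integral_add' (hHN.add (hsum.const_mul a)) (integrable_const _),
    integral_add' hHN (hsum.const_mul a),
    integral_const_mul a (fun ω => ∑ s ∈ Finset.range N, Gᶜ.indicator (1 : Ω → ℝ) (θ^[s] ω)),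
    integral_finsetSum _ fun s _ => hint s] at main
  simp only [hval, integral_const, measureReal_restrict_apply MeasurableSet.univ, Set.univ_inter,
    smul_eq_mul] at main
  have h1 : ∑ s ∈ Finset.range N, μ.real (A ∩ θ^[s] ⁻¹' Gᶜ) ≤ N * μ.real (A ∩ Gᶜ) := by
    simpa using Finset.sum_le_card_nsmul (Finset.range N) _ _ fun s _ => hbad s
  have h2 : μ.real A * (a * M) ≤ a * M :=
    mul_le_of_le_one_left (by positivity) measureReal_le_one
  nlinarith [mul_le_mul_of_nonneg_left h1 ha]

/-- If the mean growth rate is at most `γ` and the lower growth rate is almost surely at least `γ`,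
then the upper growth rate is almost surely at most `γ`. -/
lemma measure_fastSet_eq_zero [IsProbabilityMeasure μ] (h : IsSuperadditiveProcess μ θ H C)
    {γ : ℝ} (hγ : 0 ≤ γ) (hmean : ∀ n, ∫ ω, H n ω ∂μ ≤ γ * n)
    (hlow : ∀ᵐ ω ∂μ, ∀ c < γ, ∀ᶠ n : ℕ in atTop, c * n ≤ H n ω) {a : ℝ} (ha : γ < a) :
    μ (fastSet H a) = 0 := by
  set A := fastSet H a with hAdef
  have hA : MeasurableSet A := h.measurableSet_fastSet a
  have ha0 : 0 ≤ a := hγ.trans ha.le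
  let G : ℕ → Set Ω := fun M => {ω | ∃ n, 1 ≤ n ∧ n ≤ M ∧ a * n ≤ H n ω}
  have hGm : ∀ M, MeasurableSet (G M) := fun M => by
    have : G M = ⋃ n : ℕ, ⋃ _ : 1 ≤ n, ⋃ _ : n ≤ M, {ω | a * n ≤ H n ω} := by
      ext ω; simp only [G, Set.mem_iUnion, exists_prop]; rfl
    rw [this]
    exact .iUnion fun n => .iUnion fun _ => .iUnion fun _ =>
      measurableSet_le measurable_const (h.measurable n)
  have hδ : Tendsto (fun M => μ.real (A ∩ (G M)ᶜ)) atTop (𝓝 0) := by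
    have hanti : Antitone fun M => A ∩ (G M)ᶜ := fun M M' hMM' =>
      Set.inter_subset_inter_right _ (Set.compl_subset_compl.mpr
        fun ω ⟨n, h1, h2, h3⟩ => ⟨n, h1, h2.trans hMM', h3⟩)
    have hempty : ⋂ M, A ∩ (G M)ᶜ = ∅ := by
      rw [Set.eq_empty_iff_forall_notMem]
      intro ω hω
      rw [Set.mem_iInter] at hω
      obtain ⟨k, hk⟩ := (hω 0).1
      obtain ⟨n, hn, hn'⟩ := (frequently_atTop.mp hk) 1
      refine (hω n).2 ⟨n, hn, le_rfl, le_trans ?_ hn'⟩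
      gcongr
      have : (0 : ℝ) ≤ 1 / ((k : ℝ) + 1) := by positivity
      linarith
    have := tendsto_measure_iInter_atTop (μ := μ)
      (fun M => (hA.inter (hGm M).compl).nullMeasurableSet) hanti ⟨0, measure_ne_top _ _⟩
    rw [hempty, measure_empty] at this
    exact (ENNReal.tendsto_toReal ENNReal.zero_ne_top).comp this
  -- On the complement of `A` the mean growth rate is asymptotically at least `γ`.
  have hD : Tendsto (fun N : ℕ => ∫ ω in Aᶜ, min (H N ω / N) γ ∂μ) atTop
      (𝓝 (∫ _ω in Aᶜ, γ ∂μ)) := by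
    refine tendsto_integral_of_dominated_convergence (fun _ => γ)
      (fun N => (((h.measurable N).div_const _).min measurable_const).aestronglyMeasurable)
      (integrable_const _) (fun N => Eventually.of_forall fun ω => ?_)
      (ae_restrict_of_ae ?_)
    · rw [Real.norm_of_nonneg (le_min (div_nonneg (h.nonneg N ω) N.cast_nonneg) hγ)]
      exact min_le_right _ _
    · filter_upwards [hlow] with ω hω
      rw [tendsto_order]
      refine ⟨fun c hc => ?_, fun c hc => Eventually.of_forall fun n =>
        (min_le_right _ _).trans_lt hc⟩
      obtain ⟨d, hcd, hd⟩ := exists_between hc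
      filter_upwards [hω d hd, eventually_gt_atTop 0] with n hn hn0
      have : (0 : ℝ) < n := by exact_mod_cast hn0
      exact lt_min (hcd.trans_le ((le_div_iff₀ this).mpr hn)) hc
  rw [integral_const, measureReal_restrict_apply MeasurableSet.univ, Set.univ_inter, smul_eq_mul,
    probReal_compl_eq_one_sub hA] at hD
  have hineq : ∀ M N : ℕ, 1 ≤ N → a * μ.real A ≤
      γ - ∫ ω in Aᶜ, min (H N ω / N) γ ∂μ + a * μ.real (A ∩ (G M)ᶜ) + a * M / N := by
    intro M N hN
    have hN0 : (0 : ℝ) < N := by exact_mod_cast hN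
    have h1 := h.setIntegral_fastSet_ge ha0 M N (hGm M) (fun ω hω => hω)
    have h2 := integral_add_compl hA (h.integrable N)
    have h3 : N * ∫ ω in Aᶜ, min (H N ω / N) γ ∂μ ≤ ∫ ω in Aᶜ, H N ω ∂μ := by
      rw [← integral_const_mul]
      refine integral_mono_of_nonneg (Eventually.of_forall fun ω => ?_)
        (h.integrable N).restrict (Eventually.of_forall fun ω => ?_)
      · exact mul_nonneg hN0.le (le_min (div_nonneg (h.nonneg N ω) hN0.le) hγ)
      · calc N * min (H N ω / N) γ ≤ N * (H N ω / N) := by gcongr; exact min_le_left _ _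
          _ = H N ω := by field_simp
    have h4 := hmean N
    rw [← hAdef] at h1
    have e : a * M / N * N = a * M := by field_simp
    refine le_of_mul_le_mul_right ?_ hN0
    nlinarith
  have hlim : ∀ M : ℕ, a * μ.real A ≤
      γ - (1 - μ.real A) * γ + a * μ.real (A ∩ (G M)ᶜ) + 0 := fun M => by
    refine ge_of_tendsto (((hD.const_sub γ).add_const _).add
      (tendsto_const_div_atTop_nhds_zero_nat (a * M))) ?_
    filter_upwards [eventually_ge_atTop 1] with N hN using hineq M N hN
  have hfin := ge_of_tendsto (((hδ.const_mul a).const_add (γ - (1 - μ.real A) * γ)).add_const 0)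
    (Eventually.of_forall hlim)
  have hzero : μ.real A = 0 := by
    have : 0 ≤ μ.real A := measureReal_nonneg
    nlinarith
  exact (measureReal_eq_zero_iff).mp hzero

/-- A superadditive process whose blocks are independent has a deterministic growth rate. -/
theorem exists_ae_tendsto [IsProbabilityMeasure μ] (h : IsSuperadditiveProcess μ θ H C)
    (hind : ∀ m, Pairwise fun k l => ProbabilityTheory.IndepFun
      (fun ω => H m (θ^[k * m] ω)) (fun ω => H m (θ^[l * m] ω)) μ) :
    ∃ γ : ℝ, 0 ≤ γ ∧ ∀ᵐ ω ∂μ, Tendsto (fun n : ℕ => H n ω / n) atTop (𝓝 γ) := by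
  let r : ℕ → ℝ := fun m => (∫ ω, H (m + 1) ω ∂μ) / (m + 1 : ℕ)
  have hbdd : BddAbove (Set.range r) := by
    refine ⟨C, ?_⟩
    rintro _ ⟨m, rfl⟩
    have hm : (0 : ℝ) < (m + 1 : ℕ) := by positivity
    rw [div_le_iff₀ hm]
    have := integral_mono (h.integrable (m + 1)) (integrable_const (C * (m + 1 : ℕ)))
      (fun ω => h.le (m + 1) ω)
    simpa using this
  have hr0 : 0 ≤ r 0 := div_nonneg (integral_nonneg fun ω => h.nonneg _ ω) (Nat.cast_nonneg _)
  have hγ : 0 ≤ ⨆ m, r m := hr0.trans (le_ciSup hbdd 0)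
  refine ⟨⨆ m, r m, hγ, ?_⟩
  have hmean : ∀ n, ∫ ω, H n ω ∂μ ≤ (⨆ m, r m) * n := by
    rintro (_ | m)
    · have : ∀ ω, H 0 ω = 0 := fun ω => le_antisymm (by simpa using h.le 0 ω) (h.nonneg 0 ω)
      simp [this]
    · rw [← div_le_iff₀ (by positivity)]
      exact le_ciSup hbdd m
  have hlow : ∀ᵐ ω ∂μ, ∀ c < ⨆ m, r m, ∀ᶠ n : ℕ in atTop, c * n ≤ H n ω := by
    have := ae_all_iff.mpr fun m : ℕ => h.ae_eventually_ge_of_block (m + 1) (by omega) (hind _)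
    filter_upwards [this] with ω hω c hc
    obtain ⟨m, hm⟩ := exists_lt_of_lt_ciSup hc
    exact hω m c hm
  have hup : ∀ᵐ ω ∂μ, ∀ j : ℕ, ω ∉ fastSet H ((⨆ m, r m) + 1 / ((j : ℝ) + 1)) :=
    ae_all_iff.mpr fun j => measure_eq_zero_iff_ae_notMem.mp
      (h.measure_fastSet_eq_zero hγ hmean hlow (lt_add_of_pos_right _ (by positivity)))
  filter_upwards [hlow, hup] with ω h1 h2
  rw [tendsto_order]
  constructor
  · intro c hc
    obtain ⟨d, hcd, hd⟩ := exists_between hc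
    filter_upwards [h1 d hd, eventually_gt_atTop 0] with n hn hn0
    have : (0 : ℝ) < n := by exact_mod_cast hn0
    exact hcd.trans_le ((le_div_iff₀ this).mpr hn)
  · intro c hc
    obtain ⟨j, hj⟩ := exists_nat_one_div_lt (half_pos (sub_pos.mpr hc))
    have h3 := h2 j
    simp only [fastSet, Set.mem_ofPred_eq, not_exists, not_frequently, not_le] at h3
    filter_upwards [h3 j, eventually_gt_atTop 0] with n hn hn0
    have : (0 : ℝ) < n := by exact_mod_cast hn0
    rw [div_lt_iff₀ this]
    refine hn.trans_le ?_
    gcongr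
    linarith

end IsSuperadditiveProcess

/-! ### The CS6V model driven by independent uniform noise -/

/-- One number in `[0, 1]` for every vertex; only vertices with positive coordinates are used. -/
abbrev Noise : Type := ℕ × ℕ → unitInterval

/-- The law of independent uniform noise. -/
noncomputable def noiseMeasure : Measure Noise := Measure.infinitePi fun _ => volume

instance : IsProbabilityMeasure noiseMeasure := by
  unfold noiseMeasure; infer_instance

/-- The noise bit that decides the outputs of a vertex with two input lines. -/
noncomputable def pairBit (b₁ : ℕ → ℕ → ℝ) (u : Noise) (i j : ℕ) : Bool :=
  decide ((u (i, j) : ℝ) ≤ b₁ i j)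

/-- The noise bit that decides the outputs of a vertex without input lines. -/
noncomputable def vacantBit (b₂ : ℕ → ℕ → ℝ) (u : Noise) (i j : ℕ) : Bool :=
  decide (b₂ i j < (u (i, j) : ℝ))

/-- The outputs of the vertices of the CS6V model with empty boundary, as a function of the noise. -/
noncomputable def noiseOut (b₁ b₂ : ℕ → ℕ → ℝ) (u : Noise) : ℕ → ℕ → Bool × Bool :=
  evolve (pairBit b₁ u) (vacantBit b₂ u) (fun _ => false)

lemma measurable_vertexOut {Ω : Type*} [MeasurableSpace Ω] {f g h k : Ω → Bool}
    (hf : Measurable f) (hg : Measurable g) (hh : Measurable h) (hk : Measurable k) :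
    Measurable fun ω => vertexOut (f ω) (g ω) (h ω) (k ω) :=
  (measurable_of_countable fun x : (Bool × Bool) × Bool × Bool =>
    vertexOut x.1.1 x.1.2 x.2.1 x.2.2).comp ((hf.prodMk hg).prodMk (hh.prodMk hk))

/-- The outputs of the vertex `(i, j)` only depend on the noise in the rectangle below it. -/
lemma measurable_evolve {Ω : Type*} {m : MeasurableSpace Ω} {α β : Ω → ℕ → ℕ → Bool}
    (bot : ℕ → Bool) : ∀ i j,
    (∀ i' j', i' < i → j' < j → Measurable (fun ω => α ω (i' + 1) (j' + 1)) ∧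
      Measurable (fun ω => β ω (i' + 1) (j' + 1))) →
    Measurable fun ω => evolve (α ω) (β ω) bot i j
  | i, 0, _ => by simp only [evolve]; exact measurable_const
  | 0, _ + 1, _ => by simp only [evolve]; exact measurable_const
  | i + 1, j + 1, h => by
    simp only [evolve]
    exact measurable_vertexOut (h i j (by omega) (by omega)).1 (h i j (by omega) (by omega)).2
      (measurable_evolve bot (i + 1) j fun i' j' h1 h2 => h i' j' h1 (by omega)).fst
      (measurable_evolve bot i (j + 1) fun i' j' h1 h2 => h i' j' (by omega) h2).snd

/-- The σ-algebra generated by the noise at the vertices in `S`. -/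
abbrev noiseSigma (S : Set (ℕ × ℕ)) : MeasurableSpace Noise :=
  ⨆ p ∈ S, MeasurableSpace.comap (fun u : Noise => u p) inferInstance

lemma noiseSigma_le (S : Set (ℕ × ℕ)) : noiseSigma S ≤ MeasurableSpace.pi :=
  iSup₂_le fun p _ => (measurable_pi_apply p).comap_le

lemma measurable_noiseSigma_apply {S : Set (ℕ × ℕ)} {p : ℕ × ℕ} (hp : p ∈ S) :
    Measurable[noiseSigma S] fun u : Noise => u p :=
  measurable_iff_comap_le.mpr (le_iSup₂_of_le p hp le_rfl)

lemma indep_noiseSigma {S S' : Set (ℕ × ℕ)} (h : Disjoint S S') :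
    ProbabilityTheory.Indep (noiseSigma S) (noiseSigma S') noiseMeasure := by
  refine ProbabilityTheory.indep_iSup_of_disjoint (fun p => (measurable_pi_apply p).comap_le) ?_ h
  exact ProbabilityTheory.iIndepFun_infinitePi (P := fun _ : ℕ × ℕ => (volume : Measure unitInterval))
    (X := fun _ x => x) (fun _ => measurable_id)

lemma measurable_decide_le (b : ℝ) : Measurable fun v : unitInterval => decide ((v : ℝ) ≤ b) :=
  measurable_to_bool (by
    simpa [Set.preimage] using measurableSet_le measurable_subtype_coe measurable_const)

lemma measurable_decide_lt (b : ℝ) : Measurable fun v : unitInterval => decide (b < (v : ℝ)) :=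
  measurable_to_bool (by
    simpa [Set.preimage] using measurableSet_lt measurable_const measurable_subtype_coe)

/-- Translation of the noise by the vector `(a, b)`. -/
def shiftNoise (a b : ℕ) (u : Noise) : Noise := fun q => u (q.1 + a, q.2 + b)

lemma measurable_pairBit (b₁ : ℕ → ℕ → ℝ) {S : Set (ℕ × ℕ)} {i j a b : ℕ}
    (h : (i + a, j + b) ∈ S) :
    Measurable[noiseSigma S] fun u : Noise => pairBit b₁ (shiftNoise a b u) i j :=
  (measurable_decide_le _).comp (measurable_noiseSigma_apply h)

lemma measurable_vacantBit (b₂ : ℕ → ℕ → ℝ) {S : Set (ℕ × ℕ)} {i j a b : ℕ}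
    (h : (i + a, j + b) ∈ S) :
    Measurable[noiseSigma S] fun u : Noise => vacantBit b₂ (shiftNoise a b u) i j :=
  (measurable_decide_lt _).comp (measurable_noiseSigma_apply h)

lemma measurable_noiseOut_shiftNoise (b₁ b₂ : ℕ → ℕ → ℝ) {S : Set (ℕ × ℕ)} {i j a b : ℕ}
    (h : ∀ i' j', i' < i → j' < j → (i' + 1 + a, j' + 1 + b) ∈ S) :
    Measurable[noiseSigma S] fun u : Noise => noiseOut b₁ b₂ (shiftNoise a b u) i j :=
  measurable_evolve (m := noiseSigma S) _ i j fun i' j' h1 h2 =>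
    ⟨measurable_pairBit b₁ (h i' j' h1 h2), measurable_vacantBit b₂ (h i' j' h1 h2)⟩

lemma measurable_noiseOut (b₁ b₂ : ℕ → ℕ → ℝ) {S : Set (ℕ × ℕ)} {i j : ℕ}
    (h : ∀ i' j', i' < i → j' < j → (i' + 1, j' + 1) ∈ S) :
    Measurable[noiseSigma S] fun u : Noise => noiseOut b₁ b₂ u i j :=
  measurable_noiseOut_shiftNoise b₁ b₂ (a := 0) (b := 0) h

/-- For uniform noise the outputs of a vertex are distributed according to the CS6V weights. -/
lemma volume_vertexOut {b₁ b₂ : ℝ} (h₁ : b₁ ∈ Set.Icc (0 : ℝ) 1) (h₂ : b₂ ∈ Set.Icc (0 : ℝ) 1)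
    (inB inL outT outR : Bool) :
    (volume : Measure unitInterval).real
      {v | vertexOut (decide ((v : ℝ) ≤ b₁)) (decide (b₂ < (v : ℝ))) inB inL = (outT, outR)} =
      cs6vWeight b₁ b₂ inB inL outT outR := by
  have e1 : {v : unitInterval | (v : ℝ) ≤ b₁} = Set.Iic ⟨b₁, h₁⟩ := rfl
  have e2 : {v : unitInterval | b₁ < (v : ℝ)} = Set.Ioi ⟨b₁, h₁⟩ := rfl
  have e3 : {v : unitInterval | (v : ℝ) ≤ b₂} = Set.Iic ⟨b₂, h₂⟩ := rfl
  have e4 : {v : unitInterval | b₂ < (v : ℝ)} = Set.Ioi ⟨b₂, h₂⟩ := rfl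
  have e5 : ∀ b : ℝ, {v : unitInterval | (v : ℝ) ≤ b ∧ b < v} = ∅ := fun b =>
    Set.eq_empty_of_forall_notMem fun v hv => hv.1.not_gt hv.2
  have e6 : ∀ b : ℝ, {v : unitInterval | b < v ∧ (v : ℝ) ≤ b} = ∅ := fun b =>
    Set.eq_empty_of_forall_notMem fun v hv => hv.2.not_gt hv.1
  have := h₁.1
  have := h₁.2
  have := h₂.1
  have := h₂.2
  cases inB <;> cases inL <;> cases outT <;> cases outR <;>
    simp [vertexOut, cs6vWeight, Measure.real, *]

lemma noiseMeasure_real_eval (p : ℕ × ℕ) {S : Set unitInterval} (hS : MeasurableSet S) :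
    noiseMeasure.real {u | u p ∈ S} = (volume : Measure unitInterval).real S :=
  (measurePreserving_eval_infinitePi (fun _ : ℕ × ℕ => (volume : Measure unitInterval))
    p).measureReal_preimage hS.nullMeasurableSet

/-- The configuration built from uniform noise is a realization of the CS6V model. -/
theorem isCS6V_noiseOut {b₁ b₂ : ℕ → ℕ → ℝ}
    (hb₁ : ∀ i j, 1 ≤ i → 1 ≤ j → b₁ i j ∈ Set.Icc (0 : ℝ) 1)
    (hb₂ : ∀ i j, 1 ≤ i → 1 ≤ j → b₂ i j ∈ Set.Icc (0 : ℝ) 1) :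
    IsCS6V noiseMeasure b₁ b₂ (fun i j u => (noiseOut b₁ b₂ u i j).1)
      (fun i j u => (noiseOut b₁ b₂ u i j).2) where
  measurable_top i j := ((measurable_noiseOut b₁ b₂ (S := Set.univ) (by simp)).mono
    (noiseSigma_le _) le_rfl).fst
  measurable_right i j := ((measurable_noiseOut b₁ b₂ (S := Set.univ) (by simp)).mono
    (noiseSigma_le _) le_rfl).snd
  bottom_empty i _ u := evolve_zero_bottom _ _ _ i
  left_empty j _ u := evolve_zero_left _ _ _ j
  sampling i j hi hj A hA inB inL outT outR := by
    obtain ⟨i, rfl⟩ := Nat.exists_eq_add_of_le' hi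
    obtain ⟨j, rfl⟩ := Nat.exists_eq_add_of_le' hj
    simp only [Nat.add_sub_cancel]
    set q : ℕ × ℕ := (i + 1, j + 1) with hq
    set B := {u : Noise | (noiseOut b₁ b₂ u (i + 1) j).1 = inB ∧
      (noiseOut b₁ b₂ u i (j + 1)).2 = inL} with hB
    set V : Set unitInterval := {v | vertexOut (decide ((v : ℝ) ≤ b₁ (i + 1) (j + 1)))
      (decide (b₂ (i + 1) (j + 1) < (v : ℝ))) inB inL = (outT, outR)} with hV
    have hVm : MeasurableSet V := by
      exact measurable_vertexOut (measurable_decide_le _) (measurable_decide_lt _)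
        measurable_const measurable_const
        (measurableSet_singleton (outT, outR))
    -- Given its inputs, the outputs of the vertex `q` are a function of its own noise, which is
    -- independent of `A` and of the inputs.
    have hrewrite : A ∩ B ∩ {u | (noiseOut b₁ b₂ u (i + 1) (j + 1)).1 = outT ∧
        (noiseOut b₁ b₂ u (i + 1) (j + 1)).2 = outR} = A ∩ B ∩ {u | u q ∈ V} := by
      ext u
      refine and_congr_right fun hu => ?_
      have h1 : (noiseOut b₁ b₂ u (i + 1) j).1 = inB := hu.2.1
      have h2 : (noiseOut b₁ b₂ u i (j + 1)).2 = inL := hu.2.2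
      have h3 : noiseOut b₁ b₂ u (i + 1) (j + 1) = vertexOut
          (pairBit b₁ u (i + 1) (j + 1)) (vacantBit b₂ u (i + 1) (j + 1)) inB inL := by
        rw [← h1, ← h2]; simp only [noiseOut, evolve]
      change _ ∧ _ ↔ vertexOut _ _ _ _ = _
      rw [h3, Prod.ext_iff]
      rfl
    have hpast : cs6vPast (fun i j u => (noiseOut b₁ b₂ u i j).1)
        (fun i j u => (noiseOut b₁ b₂ u i j).2) q ≤ noiseSigma {q}ᶜ := by
      refine iSup_le fun ⟨p, hp1, hp2, hpq⟩ => ?_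
      have hm : Measurable[noiseSigma {q}ᶜ] fun u : Noise => noiseOut b₁ b₂ u p.1 p.2 :=
        measurable_noiseOut b₁ b₂ fun i' j' h1 h2 => by
          simp only [hq, Set.mem_compl_iff, Set.mem_singleton_iff, Prod.mk.injEq]
          simp only [SampledBefore, hq] at hpq
          omega
      exact sup_le (measurable_iff_comap_le.mp hm.fst) (measurable_iff_comap_le.mp hm.snd)
    have hBm : MeasurableSet[noiseSigma {q}ᶜ] B := by
      have h1 : Measurable[noiseSigma {q}ᶜ] fun u : Noise => noiseOut b₁ b₂ u (i + 1) j :=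
        measurable_noiseOut b₁ b₂ fun i' j' h1 h2 => by
          simp only [hq, Set.mem_compl_iff, Set.mem_singleton_iff, Prod.mk.injEq]
          omega
      have h2 : Measurable[noiseSigma {q}ᶜ] fun u : Noise => noiseOut b₁ b₂ u i (j + 1) :=
        measurable_noiseOut b₁ b₂ fun i' j' h1 h2 => by
          simp only [hq, Set.mem_compl_iff, Set.mem_singleton_iff, Prod.mk.injEq]
          omega
      exact MeasurableSet.inter (h1.fst (measurableSet_singleton inB))
        (h2.snd (measurableSet_singleton inL))
    have hAB : MeasurableSet[noiseSigma {q}ᶜ] (A ∩ B) := MeasurableSet.inter (hpast A hA) hBm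
    have hq' : MeasurableSet[noiseSigma {q}] {u : Noise | u q ∈ V} :=
      measurable_noiseSigma_apply (Set.mem_singleton q) hVm
    have hind := (ProbabilityTheory.Indep_iff _ _ _).mp
      (indep_noiseSigma (S := {q}ᶜ) (S' := {q}) disjoint_compl_left) _ _ hAB hq'
    rw [hrewrite, Measure.real, hind, ENNReal.toReal_mul, mul_comm]
    congr 1
    exact (noiseMeasure_real_eval q hVm).trans
      (volume_vertexOut (hb₁ _ _ hi hj) (hb₂ _ _ hi hj) _ _ _ _)

/-! ### Uniqueness of the law of the CS6V model -/

/-- The outputs (top, right) of all vertices; the entry at `(i, j)` belongs to the vertex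
`(i + 1, j + 1)`. -/
def outputs {Ω : Type*} (top right : ℕ → ℕ → Ω → Bool) (ω : Ω) (p : ℕ × ℕ) : Bool × Bool :=
  (top (p.1 + 1) (p.2 + 1) ω, right (p.1 + 1) (p.2 + 1) ω)

/-- The bottom input of a vertex, read off from the outputs `c`. -/
def bottomInput (c : ℕ × ℕ → Bool × Bool) : ℕ × ℕ → Bool
  | (_, 0) => false
  | (i, j + 1) => (c (i, j)).1

/-- The left input of a vertex, read off from the outputs `c`. -/
def leftInput (c : ℕ × ℕ → Bool × Bool) : ℕ × ℕ → Bool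
  | (0, _) => false
  | (i + 1, j) => (c (i, j)).2

lemma IsCS6V.bottomInput_outputs {Ω : Type*} [MeasurableSpace Ω] {P : Measure Ω}
    {b₁ b₂ : ℕ → ℕ → ℝ} {top right : ℕ → ℕ → Ω → Bool} (h : IsCS6V P b₁ b₂ top right) (i j : ℕ)
    (ω : Ω) : bottomInput (outputs top right ω) (i, j) = top (i + 1) j ω := by
  cases j with
  | zero => exact (h.bottom_empty _ (by simp) ω).symm
  | succ j => rfl

/-- The probability of prescribed outputs on an initial segment of the sampling order is the product
of the weights. -/
lemma IsCS6V.real_outputs_eq {Ω : Type*} [MeasurableSpace Ω] {P : Measure Ω}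
    [IsProbabilityMeasure P] {b₁ b₂ : ℕ → ℕ → ℝ} {top right : ℕ → ℕ → Ω → Bool}
    (h : IsCS6V P b₁ b₂ top right) (c : ℕ × ℕ → Bool × Bool) (D : Finset (ℕ × ℕ))
    (hD : ∀ p ∈ D, ∀ q, SampledBefore q p → q ∈ D) :
    P.real {ω | ∀ p ∈ D, outputs top right ω p = c p} =
      ∏ p ∈ D, cs6vWeight (b₁ (p.1 + 1) (p.2 + 1)) (b₂ (p.1 + 1) (p.2 + 1))
        (bottomInput c p) (leftInput c p) (c p).1 (c p).2 := by
  classical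
  induction D using Finset.induction_on_max_value
    (fun p : ℕ × ℕ => (toLex (p.1 + p.2, p.2) : ℕ ×ₗ ℕ)) with
  | empty => simp
  | insert q s hqs hmax ih =>
    have hbefore : ∀ p ∈ s, SampledBefore p q := fun p hp => by
      have h1 := hmax p hp
      have h2 : p ≠ q := fun h => hqs (h ▸ hp)
      rw [Prod.Lex.le_iff] at h1
      simp only [ofLex_toLex] at h1
      unfold SampledBefore
      rw [ne_eq, Prod.ext_iff] at h2
      omega
    have hmem : ∀ p, SampledBefore p q → p ∈ s := fun p hp => by
      refine Finset.mem_of_mem_insert_of_ne (hD q (Finset.mem_insert_self _ _) p hp) ?_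
      rintro rfl
      unfold SampledBefore at hp
      omega
    have hs : ∀ p ∈ s, ∀ r, SampledBefore r p → r ∈ s := fun p hp r hr => by
      refine hmem r ?_
      have := hbefore p hp
      unfold SampledBefore at this hr ⊢
      omega
    rw [Finset.prod_insert hqs, ← ih hs]
    set A := {ω | ∀ p ∈ s, outputs top right ω p = c p} with hA
    have hAm : MeasurableSet[cs6vPast top right (q.1 + 1, q.2 + 1)] A := by
      have : A = ⋂ p ∈ s, {ω | outputs top right ω p = c p} := by
        ext ω; simp [hA]
      rw [this]
      refine MeasurableSet.biInter s.countable_toSet fun p hp => ?_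
      have hp' : SampledBefore (p.1 + 1, p.2 + 1) (q.1 + 1, q.2 + 1) := by
        have := hbefore p hp
        unfold SampledBefore at this ⊢
        omega
      have hle := le_iSup (fun p : {p : ℕ × ℕ // 1 ≤ p.1 ∧ 1 ≤ p.2 ∧
          SampledBefore p (q.1 + 1, q.2 + 1)} =>
        MeasurableSpace.comap (top p.1.1 p.1.2) ⊤ ⊔ MeasurableSpace.comap (right p.1.1 p.1.2) ⊤)
        ⟨(p.1 + 1, p.2 + 1), by simp, by simp, hp'⟩
      have h1 : Measurable[cs6vPast top right (q.1 + 1, q.2 + 1)] (top (p.1 + 1) (p.2 + 1)) :=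
        measurable_iff_comap_le.mpr (le_sup_left.trans hle)
      have h2 : Measurable[cs6vPast top right (q.1 + 1, q.2 + 1)] (right (p.1 + 1) (p.2 + 1)) :=
        measurable_iff_comap_le.mpr (le_sup_right.trans hle)
      exact (h1.prodMk h2) (measurableSet_singleton (c p))
    -- On `A` the inputs of `q` are determined, since its neighbours below and to the left lie in `s`.
    have hin : A ∩ {ω | top (q.1 + 1) (q.2 + 1 - 1) ω = bottomInput c q ∧
        right (q.1 + 1 - 1) (q.2 + 1) ω = leftInput c q} = A := by
      rw [Set.inter_eq_left]
      intro ω hω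
      obtain ⟨i, j⟩ := q
      constructor
      · cases j with
        | zero => exact h.bottom_empty _ (by simp) ω
        | succ j =>
          have := hω (i, j) (hmem _ (by unfold SampledBefore; simp))
          exact congrArg Prod.fst this
      · cases i with
        | zero => exact h.left_empty _ (by simp) ω
        | succ i =>
          have := hω (i, j) (hmem _ (by unfold SampledBefore; simp))
          exact congrArg Prod.snd this
    have key := h.sampling (q.1 + 1) (q.2 + 1) (by simp) (by simp) A hAm (bottomInput c q)
      (leftInput c q) (c q).1 (c q).2
    rw [hin] at key
    rw [← key]
    congr 1
    ext ω
    simp only [Finset.forall_mem_insert, hA, Set.mem_inter_iff, Set.mem_ofPred_eq]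
    rw [and_comm]
    exact and_congr_right fun _ => Prod.ext_iff

lemma IsCS6V.measurable_outputs {Ω : Type*} [MeasurableSpace Ω] {P : Measure Ω}
    {b₁ b₂ : ℕ → ℕ → ℝ} {top right : ℕ → ℕ → Ω → Bool} (h : IsCS6V P b₁ b₂ top right) :
    Measurable (outputs top right) :=
  measurable_pi_iff.mpr fun _ => (h.measurable_top _ _).prodMk (h.measurable_right _ _)

/-- The law of the outputs of a CS6V model is determined by the parameters. -/
theorem IsCS6V.map_outputs_eq {Ω Ω' : Type*} [MeasurableSpace Ω] [MeasurableSpace Ω']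
    {P : Measure Ω} {P' : Measure Ω'} [IsProbabilityMeasure P] [IsProbabilityMeasure P']
    {b₁ b₂ : ℕ → ℕ → ℝ} {top right : ℕ → ℕ → Ω → Bool} {top' right' : ℕ → ℕ → Ω' → Bool}
    (h : IsCS6V P b₁ b₂ top right) (h' : IsCS6V P' b₁ b₂ top' right') :
    P.map (outputs top right) = P'.map (outputs top' right') := by
  have hm := h.measurable_outputs
  have hm' := h'.measurable_outputs
  refine IsProjectiveLimit.unique
    (P := fun I : Finset (ℕ × ℕ) => (P.map (outputs top right)).map I.restrict)
    (fun I => rfl) fun I => ?_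
  let D : ℕ → Finset (ℕ × ℕ) := fun n =>
    (Finset.range (n + 1) ×ˢ Finset.range (n + 1)).filter fun p => p.1 + p.2 ≤ n
  have hD : ∀ n p, p ∈ D n ↔ p.1 + p.2 ≤ n := fun n p => by
    simp only [D, Finset.mem_filter, Finset.mem_product, Finset.mem_range]
    omega
  obtain ⟨n, hn⟩ : ∃ n, I ⊆ D n :=
    ⟨I.sup fun p => p.1 + p.2, fun p hp => (hD _ _).mpr
      (Finset.le_sup (f := fun p : ℕ × ℕ => p.1 + p.2) hp)⟩
  -- It suffices to compare the finite dimensional laws on the triangles `i + j ≤ n`.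
  have hDn : (P'.map (outputs top' right')).map (D n).restrict =
      (P.map (outputs top right)).map (D n).restrict := by
    refine Measure.ext_of_singleton fun x => ?_
    have hr : Measurable ((D n).restrict : (ℕ × ℕ → Bool × Bool) → _) :=
      Finset.measurable_restrict _
    rw [Measure.map_apply hr (measurableSet_singleton x),
      Measure.map_apply hr (measurableSet_singleton x),
      Measure.map_apply hm' (hr (measurableSet_singleton x)),
      Measure.map_apply hm (hr (measurableSet_singleton x))]
    classical
    let c : ℕ × ℕ → Bool × Bool := fun p => if hp : p ∈ D n then x ⟨p, hp⟩ else (false, false)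
    have hset : ((D n).restrict : (ℕ × ℕ → Bool × Bool) → _) ⁻¹' {x} =
        {d : ℕ × ℕ → Bool × Bool | ∀ p ∈ D n, d p = c p} := by
      ext d
      simp only [Set.mem_preimage, Set.mem_singleton_iff, funext_iff, Subtype.forall,
        Finset.restrict_def]
      refine forall₂_congr fun p hp => ?_
      simp [c, hp]
    have hdown : ∀ p ∈ D n, ∀ q, SampledBefore q p → q ∈ D n := fun p hp q hq => by
      rw [hD] at hp ⊢
      unfold SampledBefore at hq
      omega
    rw [hset]
    refine (measureReal_eq_measureReal_iff).mp ?_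
    exact (h'.real_outputs_eq c _ hdown).trans (h.real_outputs_eq c _ hdown).symm
  have hcomp : (I.restrict : (ℕ × ℕ → Bool × Bool) → _) =
      Finset.restrict₂ (π := fun _ => Bool × Bool) hn ∘ (D n).restrict := rfl
  have h1 : Measurable ((D n).restrict : (ℕ × ℕ → Bool × Bool) → _) :=
    Finset.measurable_restrict _
  have h2 := Finset.measurable_restrict₂ (X := fun _ : ℕ × ℕ => Bool × Bool) hn
  change _ = (P.map (outputs top right)).map I.restrict
  rw [hcomp, ← Measure.map_map h2 h1, ← Measure.map_map h2 h1, hDn]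

/-! ### The limit along multiples of a period -/

lemma shiftNoise_iterate (a b n : ℕ) (u : Noise) :
    (shiftNoise a b)^[n] u = shiftNoise (n * a) (n * b) u := by
  induction n generalizing u with
  | zero => simp; rfl
  | succ n ih =>
    rw [Function.iterate_succ_apply, ih]
    funext q
    simp only [shiftNoise]
    congr 2 <;> ring

lemma measurePreserving_shiftNoise (a b : ℕ) :
    MeasurePreserving (shiftNoise a b) noiseMeasure noiseMeasure where
  measurable := measurable_pi_iff.mpr fun _ => measurable_pi_apply _
  map_eq := Measure.map_infinitePi_infinitePi_of_inj
    (P := fun _ : ℕ × ℕ => (volume : Measure unitInterval))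
    (f := fun q : ℕ × ℕ => (q.1 + a, q.2 + b)) fun p q h => by
      simpa [Prod.ext_iff] using h

lemma measurable_topCount {Ω : Type*} {m : MeasurableSpace Ω} {T : Ω → ℕ → ℕ → Bool} (x y : ℕ)
    (h : ∀ a < x, Measurable fun ω => T ω (a + 1) y) :
    Measurable fun ω => (topCount (T ω) x y : ℝ) := by
  have : Measurable fun ω => topCount (T ω) x y :=
    Finset.measurable_sum _ fun a ha =>
      (measurable_of_countable Bool.toNat).comp (h a (Finset.mem_range.mp ha))
  exact (measurable_of_countable (fun n : ℕ => (n : ℝ))).comp this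

/-- The height at `(x, y)` of the CS6V model built from the noise `u`. -/
noncomputable def noiseHeight (b₁ b₂ : ℕ → ℕ → ℝ) (u : Noise) (x y : ℕ) : ℕ :=
  emptyHeight (pairBit b₁ u) (vacantBit b₂ u) x y

lemma measurable_noiseHeight_shiftNoise (b₁ b₂ : ℕ → ℕ → ℝ) {S : Set (ℕ × ℕ)} {x y a b : ℕ}
    (h : ∀ i j, i < x → j < y → (i + 1 + a, j + 1 + b) ∈ S) :
    Measurable[noiseSigma S] fun u : Noise => (noiseHeight b₁ b₂ (shiftNoise a b u) x y : ℝ) :=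
  measurable_topCount (m := noiseSigma S)
    (T := fun u i j => (noiseOut b₁ b₂ (shiftNoise a b u) i j).1) x y fun i hi =>
    (measurable_noiseOut_shiftNoise b₁ b₂ (S := S) fun i' j' h1 h2 =>
      h i' j' (by omega) h2).fst

lemma periodic_mul {b : ℕ → ℕ → ℝ} {I J : ℕ}
    (hI : ∀ i j, 1 ≤ i → 1 ≤ j → b (i + I) j = b i j)
    (hJ : ∀ i j, 1 ≤ i → 1 ≤ j → b i (j + J) = b i j) {A B : ℕ} (hA : I ∣ A) (hB : J ∣ B)
    (i j : ℕ) : b (i + 1 + A) (j + 1 + B) = b (i + 1) (j + 1) := by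
  obtain ⟨k, rfl⟩ := hA
  obtain ⟨l, rfl⟩ := hB
  have h1 : ∀ k i j, b (i + 1 + I * k) (j + 1) = b (i + 1) (j + 1) := fun k => by
    induction k with
    | zero => simp
    | succ k ih =>
      intro i j
      rw [Nat.mul_succ, ← add_assoc, hI _ _ (by omega) (by omega), ih]
  have h2 : ∀ l i j, b (i + 1) (j + 1 + J * l) = b (i + 1) (j + 1) := fun l => by
    induction l with
    | zero => simp
    | succ l ih =>
      intro i j
      rw [Nat.mul_succ, ← add_assoc, hJ _ _ (by omega) (by omega), ih]
  have h3 := h2 l (i + I * k) j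
  rw [add_right_comm i] at h3
  rw [h3, h1]

section Periodic

variable {b₁ b₂ : ℕ → ℕ → ℝ} {I J : ℕ}

/-- Translating the noise by a period amounts to restarting the model, with empty boundary, at the
translated corner; superadditivity of the height then becomes superadditivity along the
translation. -/
lemma isSuperadditiveProcess_noiseHeight
    (hperI₁ : ∀ i j, 1 ≤ i → 1 ≤ j → b₁ (i + I) j = b₁ i j)
    (hperJ₁ : ∀ i j, 1 ≤ i → 1 ≤ j → b₁ i (j + J) = b₁ i j)
    (hperI₂ : ∀ i j, 1 ≤ i → 1 ≤ j → b₂ (i + I) j = b₂ i j)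
    (hperJ₂ : ∀ i j, 1 ≤ i → 1 ≤ j → b₂ i (j + J) = b₂ i j)
    {X Y : ℕ} (hX : I ∣ X) (hY : J ∣ Y) :
    IsSuperadditiveProcess noiseMeasure (shiftNoise X Y)
      (fun n u => (noiseHeight b₁ b₂ u (n * X) (n * Y) : ℝ)) X where
  measurePreserving := measurePreserving_shiftNoise X Y
  measurable n := (measurable_noiseHeight_shiftNoise b₁ b₂ (S := Set.univ) (a := 0) (b := 0)
    (by simp)).mono (noiseSigma_le _) le_rfl
  nonneg n u := Nat.cast_nonneg _
  le n u := by
    have : noiseHeight b₁ b₂ u (n * X) (n * Y) ≤ n * X := by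
      unfold noiseHeight emptyHeight
      exact topCount_le _ _ _
    calc (noiseHeight b₁ b₂ u (n * X) (n * Y) : ℝ) ≤ (n * X : ℕ) := Nat.cast_le.mpr this
      _ = X * n := by push_cast; ring
  superadditive m n u := by
    have h := emptyHeight_superadditive (pairBit b₁ u) (vacantBit b₂ u) (m * X) (m * Y)
      (n * X) (n * Y)
    rw [← add_mul, ← add_mul, add_comm n m] at h
    have e : emptyHeight (fun i j => pairBit b₁ u (i + m * X) (j + m * Y))
        (fun i j => vacantBit b₂ u (i + m * X) (j + m * Y)) (n * X) (n * Y) =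
        noiseHeight b₁ b₂ ((shiftNoise X Y)^[m] u) (n * X) (n * Y) := by
      rw [shiftNoise_iterate]
      unfold noiseHeight emptyHeight
      congr 1
      funext i j
      congr 1
      apply evolve_congr
      · intro i j
        rw [pairBit, pairBit, decide_eq_decide,
          periodic_mul hperI₁ hperJ₁ (hX.mul_left m) (hY.mul_left m)]
        rfl
      · intro i j
        rw [vacantBit, vacantBit, decide_eq_decide,
          periodic_mul hperI₂ hperJ₂ (hX.mul_left m) (hY.mul_left m)]
        rfl
    rw [e] at h
    exact_mod_cast h

/-- Heights of disjoint diagonal blocks depend on the noise in disjoint strips. -/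
lemma indepFun_noiseHeight (b₁ b₂ : ℕ → ℕ → ℝ) (X Y m : ℕ) :
    Pairwise fun k l => ProbabilityTheory.IndepFun
      (fun u => (noiseHeight b₁ b₂ ((shiftNoise X Y)^[k * m] u) (m * X) (m * Y) : ℝ))
      (fun u => (noiseHeight b₁ b₂ ((shiftNoise X Y)^[l * m] u) (m * X) (m * Y) : ℝ))
      noiseMeasure := by
  intro k l hkl
  let S : ℕ → Set (ℕ × ℕ) := fun k => {q | k * m * X < q.1 ∧ q.1 ≤ (k + 1) * m * X}
  have hS : ∀ k, Measurable[noiseSigma (S k)] fun u =>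
      (noiseHeight b₁ b₂ ((shiftNoise X Y)^[k * m] u) (m * X) (m * Y) : ℝ) := fun k => by
    simp only [shiftNoise_iterate]
    refine measurable_noiseHeight_shiftNoise b₁ b₂ fun i j hi hj => ⟨by simp, ?_⟩
    simp only [add_mul, one_mul]
    omega
  have hdisj : Disjoint (S k) (S l) := by
    rw [Set.disjoint_left]
    rintro q ⟨h1, h2⟩ ⟨h3, h4⟩
    rcases hkl.lt_or_gt with h | h
    · have : (k + 1) * m * X ≤ l * m * X := by gcongr; omega
      omega
    · have : (l + 1) * m * X ≤ k * m * X := by gcongr; omega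
      omega
  exact ProbabilityTheory.indep_of_indep_of_le_left
    (ProbabilityTheory.indep_of_indep_of_le_right (indep_noiseSigma hdisj)
      (measurable_iff_comap_le.mp (hS l))) (measurable_iff_comap_le.mp (hS k))

end Periodic

/-! ### Interpolation between periods and transfer to arbitrary realizations -/

lemma tendsto_div_of_monotone_of_tendsto_multiples {f : ℕ → ℝ} (hf : Monotone f) {p : ℕ}
    (hp : 1 ≤ p) {γ : ℝ} (h : Tendsto (fun k : ℕ => f (k * p) / k) atTop (𝓝 γ)) :
    Tendsto (fun n : ℕ => f n / n) atTop (𝓝 (γ / p)) := by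
  have hp0 : (0 : ℝ) < p := by exact_mod_cast hp
  refine tendsto_div_of_monotone_of_exists_subseq_tendsto_div f _ hf fun a ha =>
    ⟨fun k => k * p, ?_, ?_, ?_⟩
  · filter_upwards [(tendsto_natCast_atTop_atTop.const_mul_atTop
      (sub_pos.mpr ha)).eventually_ge_atTop (1 : ℝ)] with k hk
    push_cast
    nlinarith
  · exact tendsto_id.atTop_mul_const' (by omega)
  · refine (h.div_const (p : ℝ)).congr fun k => ?_
    push_cast
    rw [div_div]

lemma exists_nat_multiple {x y : ℚ} (hx : 0 ≤ x) (hy : 0 ≤ y) {I J : ℕ} (hI : 1 ≤ I)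
    (hJ : 1 ≤ J) : ∃ p X Y : ℕ, 1 ≤ p ∧ I ∣ X ∧ J ∣ Y ∧ (p : ℚ) * x = X ∧ (p : ℚ) * y = Y := by
  have hnx : ((x.num.toNat : ℕ) : ℚ) = x.num := by
    exact_mod_cast Int.toNat_of_nonneg (Rat.num_nonneg.mpr hx)
  have hny : ((y.num.toNat : ℕ) : ℚ) = y.num := by
    exact_mod_cast Int.toNat_of_nonneg (Rat.num_nonneg.mpr hy)
  refine ⟨x.den * y.den * I * J, x.num.toNat * y.den * J * I, y.num.toNat * x.den * I * J, ?_,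
    dvd_mul_left _ _, dvd_mul_left _ _, ?_, ?_⟩
  · have := x.den_pos
    have := y.den_pos
    exact Nat.mul_pos (Nat.mul_pos (Nat.mul_pos ‹_› ‹_›) hI) hJ
  · push_cast
    rw [hnx, ← Rat.den_mul_eq_num]
    ring
  · push_cast
    rw [hny, ← Rat.den_mul_eq_num]
    ring

lemma cs6vHeight_eq_topCount {Ω : Type*} (top : ℕ → ℕ → Ω → Bool) (x y : ℕ) (ω : Ω) :
    cs6vHeight top x y ω = topCount (fun i j => top i j ω) x y := by
  have : Finset.Icc 1 x = (Finset.range x).map (addRightEmbedding 1) := by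
    ext a
    simp only [Finset.mem_Icc, Finset.mem_map, Finset.mem_range, addRightEmbedding_apply]
    exact ⟨fun h => ⟨a - 1, by omega, by omega⟩, fun ⟨b, h1, h2⟩ => by omega⟩
  rw [cs6vHeight, Finset.card_filter, this, Finset.sum_map]
  refine Finset.sum_congr rfl fun a _ => ?_
  cases h : top (a + 1) y ω <;> simp [h]

/-- The height as a function of the outputs of the vertices. -/
lemma IsCS6V.cs6vHeight_eq {Ω : Type*} [MeasurableSpace Ω] {P : Measure Ω}
    {b₁ b₂ : ℕ → ℕ → ℝ} {top right : ℕ → ℕ → Ω → Bool} (h : IsCS6V P b₁ b₂ top right) (x y : ℕ)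
    (ω : Ω) : cs6vHeight top x y ω =
      topCount (fun i j => bottomInput (outputs top right ω) (i - 1, j)) x y := by
  rw [cs6vHeight_eq_topCount]
  simp [topCount, h.bottomInput_outputs]

lemma measurable_bottomInput (p : ℕ × ℕ) :
    Measurable fun c : ℕ × ℕ → Bool × Bool => bottomInput c p := by
  obtain ⟨i, j⟩ := p
  cases j with
  | zero => exact measurable_const
  | succ j => exact (measurable_pi_apply (i, j)).fst

theorem proposition3p5
    (b₁ b₂ : ℕ → ℕ → ℝ)
    (hb₁ : ∀ i j, 1 ≤ i → 1 ≤ j → b₁ i j ∈ Set.Icc (0 : ℝ) 1)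
    (hb₂ : ∀ i j, 1 ≤ i → 1 ≤ j → b₂ i j ∈ Set.Icc (0 : ℝ) 1)
    (I J : ℕ) (hI : 1 ≤ I) (hJ : 1 ≤ J)
    (hperI₁ : ∀ i j, 1 ≤ i → 1 ≤ j → b₁ (i + I) j = b₁ i j)
    (hperJ₁ : ∀ i j, 1 ≤ i → 1 ≤ j → b₁ i (j + J) = b₁ i j)
    (hperI₂ : ∀ i j, 1 ≤ i → 1 ≤ j → b₂ (i + I) j = b₂ i j)
    (hperJ₂ : ∀ i j, 1 ≤ i → 1 ≤ j → b₂ i (j + J) = b₂ i j)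
    (x y : ℚ) (hx : 0 ≤ x) (hy : 0 ≤ y) :
    ∃ g : ℝ, 0 ≤ g ∧
      ∀ (Ω : Type*) [MeasurableSpace Ω] (P : Measure Ω) [IsProbabilityMeasure P]
        (top right : ℕ → ℕ → Ω → Bool), IsCS6V P b₁ b₂ top right →
        ∀ᵐ ω ∂P, Tendsto
          (fun n : ℕ => (cs6vHeight top ⌊(n : ℚ) * x⌋₊ ⌊(n : ℚ) * y⌋₊ ω : ℝ) / (n : ℝ))
          atTop (𝓝 g) := by
  obtain ⟨p, X, Y, hp, hX, hY, hpx, hpy⟩ := exists_nat_multiple hx hy hI hJ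
  obtain ⟨γ, hγ, hlim⟩ := (isSuperadditiveProcess_noiseHeight hperI₁ hperJ₁ hperI₂ hperJ₂
    hX hY).exists_ae_tendsto (indepFun_noiseHeight b₁ b₂ X Y)
  refine ⟨γ / p, by positivity, fun Ω _ P _ top right h => ?_⟩
  have h₀ := isCS6V_noiseOut hb₁ hb₂
  -- Between multiples of `p` the limit is obtained from monotonicity of the height.
  have hnoise : ∀ᵐ u ∂noiseMeasure, Tendsto
      (fun n : ℕ => (cs6vHeight (fun i j u => (noiseOut b₁ b₂ u i j).1) ⌊(n : ℚ) * x⌋₊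
        ⌊(n : ℚ) * y⌋₊ u : ℝ) / (n : ℝ)) atTop (𝓝 (γ / p)) := by
    filter_upwards [hlim] with u hu
    simp only [cs6vHeight_eq_topCount]
    refine tendsto_div_of_monotone_of_tendsto_multiples
      (f := fun n : ℕ => (noiseHeight b₁ b₂ u ⌊(n : ℚ) * x⌋₊ ⌊(n : ℚ) * y⌋₊ : ℝ))
      (fun n n' hn => ?_) hp (hu.congr fun k => ?_)
    · have hn' : (n : ℚ) ≤ n' := by exact_mod_cast hn
      exact Nat.cast_le.mpr (emptyHeight_mono _ _
        (Nat.floor_mono (mul_le_mul_of_nonneg_right hn' hx))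
        (Nat.floor_mono (mul_le_mul_of_nonneg_right hn' hy)))
    · have e1 : ⌊((k * p : ℕ) : ℚ) * x⌋₊ = k * X := by
        rw [Nat.cast_mul, mul_assoc, hpx, ← Nat.cast_mul, Nat.floor_natCast]
      have e2 : ⌊((k * p : ℕ) : ℚ) * y⌋₊ = k * Y := by
        rw [Nat.cast_mul, mul_assoc, hpy, ← Nat.cast_mul, Nat.floor_natCast]
      rw [e1, e2]
  -- The event of convergence only depends on the law of the outputs.
  simp only [h₀.cs6vHeight_eq] at hnoise
  simp only [h.cs6vHeight_eq]
  have hE : MeasurableSet {c : ℕ × ℕ → Bool × Bool | Tendsto (fun n : ℕ =>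
      (topCount (fun i j => bottomInput c (i - 1, j)) ⌊(n : ℚ) * x⌋₊ ⌊(n : ℚ) * y⌋₊ : ℝ) / (n : ℝ))
      atTop (𝓝 (γ / p))} :=
    measurableSet_tendsto (𝓝 (γ / p)) fun n =>
      (measurable_topCount _ _ fun a _ => measurable_bottomInput _).div_const _
  refine (ae_map_iff h.measurable_outputs.aemeasurable hE).mp ?_
  rw [h.map_outputs_eq h₀]
  exact (ae_map_iff h₀.measurable_outputs.aemeasurable hE).mpr hnoise
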